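/- Let $|\Phi^\pm\rangle=\frac1{\sqrt2}(|00\rangle\pm|11\rangle)$ and $|\Psi^\pm\rangle=\frac1{\sqrt2}(|01\rangle\pm|10\rangle)$ be the Bell states of two qubits, the first held by Alice and the second by Bob, and let $\sigma_+=|\Phi^+\rangle\langle\Phi^+|$. An LOCC protocol is a deterministic quantum channel that Alice and Bob can implement with finitely many rounds of local quantum operations and finite classical communication, using at most a finite amount of shared randomness. Let $\rho$ be a Bell-diagonal two-qubit state, that is, a density operator that is diagonal in the basis $\Phi^+,\Psi^+,\Phi^-,\Psi^-$, with von Neumann entropy $S(\rho)=-\operatorname{tr}[\rho\log_2\rho]<1$, and let $F<1$ be a target fidelity. Then for every sufficiently large $n\in\mathbb N$ there exist $m\in\mathbb N$ with $$m\ \ge\ \frac n2\,\bigl[1-S(\rho)\bigr]$$ and an LOCC protocol $\Lambda$ that maps $n$ qubit pairs to $m$ qubit pairs such that the state $\rho'=\Lambda(\rho^{\otimes n})$ satisfies $$\operatorname{tr}\bigl(\sigma_+^{\otimes m}\rho'\bigr)\ \ge\ F .$$ -/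

import Mathlib

open scoped Matrix Kronecker ComplexOrder

noncomputable section

namespace QInfo

/-! ### Two-qubit states, Bell states, entropy -/

/-- The product vector `|i j⟩` of a two-qubit system (first entry: Alice, second entry: Bob). -/
def ket (i j : Fin 2) : Fin 2 × Fin 2 → ℂ := Pi.single (i, j) 1

/-- The rank-one operator `|ψ⟩⟨ψ|`. -/
def proj {ι : Type*} (ψ : ι → ℂ) : Matrix ι ι ℂ := Matrix.vecMulVec ψ (star ψ)

/-- The four Bell vectors, in the order `Φ⁺, Ψ⁺, Φ⁻, Ψ⁻`. -/
def bellVec : Fin 4 → (Fin 2 × Fin 2 → ℂ) :=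
  ![(((√2 : ℝ) : ℂ)⁻¹) • (ket 0 0 + ket 1 1),
    (((√2 : ℝ) : ℂ)⁻¹) • (ket 0 1 + ket 1 0),
    (((√2 : ℝ) : ℂ)⁻¹) • (ket 0 0 - ket 1 1),
    (((√2 : ℝ) : ℂ)⁻¹) • (ket 0 1 - ket 1 0)]

/-- The target state `σ₊ = |Φ⁺⟩⟨Φ⁺|`. -/
def sigmaPlus : Matrix (Fin 2 × Fin 2) (Fin 2 × Fin 2) ℂ := proj (bellVec 0)

/-- A density operator: positive semidefinite with unit trace. -/
def IsState {ι : Type*} [Fintype ι] (ρ : Matrix ι ι ℂ) : Prop :=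
  ρ.PosSemidef ∧ ρ.trace = 1

/-- A two-qubit density operator that is diagonal in the Bell basis. -/
def IsBellDiagonalState (ρ : Matrix (Fin 2 × Fin 2) (Fin 2 × Fin 2) ℂ) : Prop :=
  IsState ρ ∧ ∃ p : Fin 4 → ℂ, ρ = ∑ x, p x • proj (bellVec x)

/-- The von Neumann entropy `S(ρ) = -tr[ρ log₂ ρ]`. The logarithm of the operator is taken by the
functional calculus; `Real.logb 2 0 = 0`, so that `0 log₂ 0 = 0` as usual. -/
def entropy {ι : Type*} [Fintype ι] [DecidableEq ι] (ρ : Matrix ι ι ℂ) : ℝ :=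
  -(ρ * cfc (Real.logb 2) ρ).trace.re

/-- The `n`-fold tensor power of a bipartite operator, regrouped as an operator on
`(Alice's n qubits) ⊗ (Bob's n qubits)`. -/
def tensorPow (ρ : Matrix (Fin 2 × Fin 2) (Fin 2 × Fin 2) ℂ) (n : ℕ) :
    Matrix ((Fin n → Fin 2) × (Fin n → Fin 2)) ((Fin n → Fin 2) × (Fin n → Fin 2)) ℂ :=
  Matrix.of fun x y => ∏ i, ρ (x.1 i, x.2 i) (y.1 i, y.2 i)

/-! ### LOCC protocols -/

/-- The map `X ↦ K X K†`. -/
def conjBy {ι κ : Type*} [Fintype ι] (K : Matrix κ ι ℂ) :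
    Matrix ι ι ℂ →ₗ[ℂ] Matrix κ κ ℂ where
  toFun X := K * X * Kᴴ
  map_add' X Y := by rw [Matrix.mul_add, Matrix.add_mul]
  map_smul' c X := by simp

/-- Alice applies the Kraus operator `K`, Bob does nothing. -/
def aliceMap {a b c : Type*} [Fintype a] [Fintype b] [DecidableEq b] (K : Matrix c a ℂ) :
    Matrix (a × b) (a × b) ℂ →ₗ[ℂ] Matrix (c × b) (c × b) ℂ :=
  conjBy (K ⊗ₖ (1 : Matrix b b ℂ))

/-- Bob applies the Kraus operator `K`, Alice does nothing. -/
def bobMap {a b c : Type*} [Fintype a] [Fintype b] [DecidableEq a] (K : Matrix c b ℂ) :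
    Matrix (a × b) (a × b) ℂ →ₗ[ℂ] Matrix (a × c) (a × c) ℂ :=
  conjBy ((1 : Matrix a a ℂ) ⊗ₖ K)

/-- A Kraus family with finitely many outcomes, `∑ₖ Kₖ† Kₖ = 1`. -/
def IsKraus {ι κ : Type*} [Fintype κ] [DecidableEq ι] {r : ℕ}
    (K : Fin r → Matrix κ ι ℂ) : Prop :=
  ∑ k, (K k)ᴴ * K k = 1

/-- `IsLOCC Λ`: the map `Λ`, from operators on `ℂᵃ ⊗ ℂᵇ` to operators on `ℂᵒ ⊗ ℂᵠ`, is implemented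
by a (deterministic) two-party protocol with finitely many rounds, finite shared randomness, local
operations, and finite classical communication. A protocol either stops (`done`), or draws a shared
random number (`shared`), or one party performs a local quantum operation with Kraus operators `Kₖ`
(possibly changing the dimension of its system) and announces the outcome `k` (`alice`, `bob`); the
rest of the protocol, again LOCC, may depend on everything that was announced. An operation part of
whose outcome is kept private or discarded is covered, as the continuation may ignore `k`. -/
inductive IsLOCC {o q : Type} [Fintype o] [DecidableEq o] [Fintype q] [DecidableEq q] :
    ∀ {a b : Type} [Fintype a] [DecidableEq a] [Fintype b] [DecidableEq b],
      (Matrix (a × b) (a × b) ℂ →ₗ[ℂ] Matrix (o × q) (o × q) ℂ) → Prop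
  | done : IsLOCC (a := o) (b := q) LinearMap.id
  | shared {a b : Type} [Fintype a] [DecidableEq a] [Fintype b] [DecidableEq b] {r : ℕ}
      (p : Fin r → ℝ) (hp : ∀ k, 0 ≤ p k) (hsum : ∑ k, p k = 1)
      (Λ : Fin r → (Matrix (a × b) (a × b) ℂ →ₗ[ℂ] Matrix (o × q) (o × q) ℂ))
      (hΛ : ∀ k, IsLOCC (Λ k)) :
      IsLOCC (∑ k, (p k : ℂ) • Λ k)
  | alice {a b c : Type} [Fintype a] [DecidableEq a] [Fintype b] [DecidableEq b]
      [Fintype c] [DecidableEq c] {r : ℕ}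
      (K : Fin r → Matrix c a ℂ) (hK : IsKraus K)
      (Λ : Fin r → (Matrix (c × b) (c × b) ℂ →ₗ[ℂ] Matrix (o × q) (o × q) ℂ))
      (hΛ : ∀ k, IsLOCC (Λ k)) :
      IsLOCC (∑ k, Λ k ∘ₗ aliceMap (K k))
  | bob {a b c : Type} [Fintype a] [DecidableEq a] [Fintype b] [DecidableEq b]
      [Fintype c] [DecidableEq c] {r : ℕ}
      (K : Fin r → Matrix c b ℂ) (hK : IsKraus K)
      (Λ : Fin r → (Matrix (a × c) (a × c) ℂ →ₗ[ℂ] Matrix (o × q) (o × q) ℂ))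
      (hΛ : ∀ k, IsLOCC (Λ k)) :
      IsLOCC (∑ k, Λ k ∘ₗ bobMap (K k))

end QInfo

end

/-!
The proof is the hashing protocol for Bell-diagonal states, with one-way communication and no shared
randomness. A Bell-diagonal state `ρ` with spectrum `p` is a mixture of Bell vectors, so `ρ^{⊗n}` is a
mixture of Bell strings `e`, drawn with probability `∏ p (e i)`, each given by a bit pattern `x` and a
phase pattern `z` in `(ℤ/2)ⁿ` (`tensorPow_sum_proj_bellVec`). With `n = k + m`, Alice and Bob both
apply the same real Clifford unitary, given by matrices `A` (controlled phases) and `R`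
(controlled-NOT gates), and measure `k` qubits in the `X` basis. The sum of their outcomes is a linear
function of `(x, z)`, the `syndrome`. From it Bob guesses the Bell string by maximum likelihood and
corrects the remaining `m` pairs by a Pauli operator. If the guess is right, these are in the state
`Φ⁺` (`normSq_overlap_codeKraus`), so that the fidelity is at least the probability of a right
guess (`exists_isLOCC_of_decoder`).

For uniformly random `A` and `R` two distinct Bell strings have the same syndrome with probability at
most `2 / 2 ^ k` (`card_syndrome_eq_zero_le`). Gallager's form of the union bound
(`exists_hash_decoder`) then yields a fixed choice of `A`, `R` with failure probability at most
`(2 / 2 ^ k) ^ l * (∑ x, p x ^ (1 - l)) ^ n` for each `l` in `[0, 1]`. Since `∑ x, p x ^ (1 - l)` is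
`2 ^ (l S(ρ) + o(l))` for small `l`, this decays exponentially in `n` when `k / n` stays above `S(ρ)`
(`exists_exponent_lt_one`), and the rate `m / n ≈ (1 - S(ρ)) / 2` leaves `k / n ≈ (1 + S(ρ)) / 2`,
which exceeds `S(ρ)`.
-/

namespace BellHashing

open QInfo
open scoped Fin.CommRing

variable {k m : ℕ}

/-! ### Decoding of random hashes -/

/-- A maximum-likelihood decoder (guess the likeliest `e` with the observed hash) fails on `e` only
if some competitor, at least as likely as `e`, shares its hash. -/
theorem exists_maxLikelihood_decoder {E Y : Type*} [Finite E] [Nonempty E] (p : E → ℝ)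
    (h : E → Y) :
    ∃ dec : Y → E, ∀ e, dec (h e) ≠ e → ∃ e', e' ≠ e ∧ h e' = h e ∧ p e ≤ p e' := by
  -- `d` maximizes `p` on the fibre over `y`; its value is immaterial if that fibre is empty
  have key : ∀ y, ∃ d, ∀ e, h e = y → h d = y ∧ p e ≤ p d := by
    intro y
    rcases Set.eq_empty_or_nonempty {e | h e = y} with hy | hy
    · exact ⟨Classical.arbitrary E, fun e he => (Set.eq_empty_iff_forall_notMem.1 hy e he).elim⟩
    · obtain ⟨d, hd, hmax⟩ := Set.exists_max_image _ p (Set.toFinite {e | h e = y}) hy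
      exact ⟨d, fun e he => ⟨hd, hmax e he⟩⟩
  choose dec hdec using key
  exact ⟨dec, fun e he => ⟨dec (h e), he, hdec _ e rfl⟩⟩

theorem min_one_le_rpow {y l : ℝ} (hy : 0 < y) (hl0 : 0 ≤ l) (hl1 : l ≤ 1) :
    min 1 y ≤ y ^ l := by
  rcases le_total 1 y with h | h
  · exact (min_le_left _ _).trans (Real.one_le_rpow h hl0)
  · refine (min_le_right _ _).trans ?_
    simpa using Real.rpow_le_rpow_of_exponent_ge hy h hl1

open Classical in
/-- Random hashing with a decoder, derandomized. For a family of hashes in which two distinct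
points collide with probability at most `δ`, some member has a decoder with failure probability at
most `δ ^ l * ∑ e, p e ^ (1 - l)`, for any `0 ≤ l ≤ 1`. At most `1 / p e` points are as likely as `e`,
so the average failure probability at `e` is at most `min 1 (δ / p e) ≤ (δ / p e) ^ l`.
The power `p e ^ (1 - l)` is written `p e * exp (-l * log (p e))`, which vanishes at `p e = 0`. -/
theorem exists_hash_decoder {E Y Θ : Type*} [Fintype E] [Nonempty E] [Fintype Θ] [Nonempty Θ]
    (p : E → ℝ) (hp : ∀ e, 0 ≤ p e) (hsum : ∑ e, p e = 1) (h : Θ → E → Y) {δ l : ℝ}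
    (hδ : 0 < δ) (hl0 : 0 ≤ l) (hl1 : l ≤ 1)
    (hcoll : ∀ e e', e' ≠ e → ((Finset.univ.filter fun θ => h θ e' = h θ e).card : ℝ)
      ≤ δ * Fintype.card Θ) :
    ∃ θ, ∃ dec : Y → E,
      1 - δ ^ l * ∑ e, p e * Real.exp (-l * Real.log (p e))
        ≤ ∑ e, if dec (h θ e) = e then p e else 0 := by
  -- the event that some competitor, at least as likely as `e`, has the same hash
  set bad : Θ → E → Prop := fun θ e => ∃ e', e' ≠ e ∧ h θ e' = h θ e ∧ p e ≤ p e' with hbad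
  have hbound : ∀ e, p e * ((Finset.univ.filter fun θ => bad θ e).card : ℝ)
      ≤ (δ ^ l * (p e * Real.exp (-l * Real.log (p e)))) * Fintype.card Θ := by
    intro e
    rcases (hp e).eq_or_lt with h0 | h0
    · simp [← h0]
    set c := Finset.univ.filter fun e' => p e ≤ p e' with hc
    have hcc : (c.card : ℝ) ≤ (p e)⁻¹ := by
      rw [← one_div, le_div_iff₀ h0, ← nsmul_eq_mul, ← hsum]
      calc c.card • p e ≤ ∑ e' ∈ c, p e' :=
            Finset.card_nsmul_le_sum _ _ _ fun e' he' => (Finset.mem_filter.1 he').2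
        _ ≤ _ := Finset.sum_le_sum_of_subset_of_nonneg (Finset.subset_univ _) fun i _ _ => hp i
    have h1 : ((Finset.univ.filter fun θ => bad θ e).card : ℝ) ≤ 1 * Fintype.card Θ := by
      rw [one_mul]; exact_mod_cast Finset.card_le_univ _
    have h2 : ((Finset.univ.filter fun θ => bad θ e).card : ℝ) ≤ δ * (p e)⁻¹ * Fintype.card Θ := by
      have hsub : (Finset.univ.filter fun θ => bad θ e) ⊆
          (c.erase e).biUnion fun e' => Finset.univ.filter fun θ => h θ e' = h θ e := by
        intro θ hθ
        obtain ⟨e', h1, h2, h3⟩ := (Finset.mem_filter.1 hθ).2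
        simp only [Finset.mem_biUnion, Finset.mem_filter, Finset.mem_univ, true_and,
          Finset.mem_erase, hc]
        exact ⟨e', ⟨h1, h3⟩, h2⟩
      calc ((Finset.univ.filter fun θ => bad θ e).card : ℝ)
          ≤ ∑ e' ∈ c.erase e, ((Finset.univ.filter fun θ => h θ e' = h θ e).card : ℝ) := by
            exact_mod_cast (Finset.card_le_card hsub).trans Finset.card_biUnion_le
        _ ≤ ∑ e' ∈ c.erase e, δ * Fintype.card Θ :=
            Finset.sum_le_sum fun e' he' => hcoll e e' (Finset.ne_of_mem_erase he')
        _ = (c.erase e).card * (δ * Fintype.card Θ) := by rw [Finset.sum_const, nsmul_eq_mul]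
        _ ≤ (p e)⁻¹ * (δ * Fintype.card Θ) := by
            gcongr
            exact (Nat.cast_le.2 (Finset.card_le_card (Finset.erase_subset _ _))).trans hcc
        _ = _ := by ring
    have h3 : ((Finset.univ.filter fun θ => bad θ e).card : ℝ)
        ≤ min 1 (δ * (p e)⁻¹) * Fintype.card Θ := by
      rcases min_choice 1 (δ * (p e)⁻¹) with h | h <;> rw [h] <;> assumption
    have h4 : (δ * (p e)⁻¹) ^ l = δ ^ l * Real.exp (-l * Real.log (p e)) := by
      rw [Real.mul_rpow hδ.le (inv_nonneg.2 h0.le), Real.rpow_def_of_pos (inv_pos.2 h0),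
        Real.log_inv]
      ring_nf
    calc p e * ((Finset.univ.filter fun θ => bad θ e).card : ℝ)
        ≤ p e * ((δ * (p e)⁻¹) ^ l * Fintype.card Θ) := by
          gcongr
          exact h3.trans (by gcongr; exact min_one_le_rpow (by positivity) hl0 hl1)
      _ = _ := by rw [h4]; ring
  have hexists : ∃ θ ∈ (Finset.univ : Finset Θ), (∑ e, if bad θ e then p e else 0)
      ≤ δ ^ l * ∑ e, p e * Real.exp (-l * Real.log (p e)) := by
    apply Finset.exists_le_of_sum_le Finset.univ_nonempty
    rw [Finset.sum_comm, Finset.sum_const, nsmul_eq_mul, Finset.card_univ, Finset.mul_sum,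
      Finset.mul_sum]
    refine Finset.sum_le_sum fun e _ => ?_
    rw [← Finset.sum_filter, Finset.sum_const, nsmul_eq_mul]
    linarith [hbound e]
  obtain ⟨θ, -, hθ⟩ := hexists
  obtain ⟨dec, hdec⟩ := exists_maxLikelihood_decoder p (h θ)
  refine ⟨θ, dec, ?_⟩
  have hle : 1 ≤ ∑ e, (if dec (h θ e) = e then p e else 0) + ∑ e, if bad θ e then p e else 0 := by
    rw [← hsum, ← Finset.sum_add_distrib]
    refine Finset.sum_le_sum fun e _ => ?_
    by_cases hd : dec (h θ e) = e
    · rw [if_pos hd]; split_ifs <;> linarith [hp e]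
    · rw [if_neg hd, if_pos (hdec e hd), zero_add]
  linarith

/-- If `c` exceeds the entropy of `p` in nats, the quantity `exp (-l c) * ∑ i, p i ^ (1 - l)` drops
below `1` for some small `l > 0`: at `l = 0` its value is `1` and its derivative `H(p) - c < 0`. -/
theorem exists_exponent_lt_one {ι : Type*} [Fintype ι] (p : ι → ℝ) (hsum : ∑ i, p i = 1) {c : ℝ}
    (hc : -∑ i, p i * Real.log (p i) < c) :
    ∃ l : ℝ, 0 < l ∧ l ≤ 1 ∧
      Real.exp (-l * c) * ∑ i, p i * Real.exp (-l * Real.log (p i)) < 1 := by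
  -- the whole expression, with both exponentials merged
  set g : ℝ → ℝ := fun l => ∑ i, p i * Real.exp (l * (-Real.log (p i) - c)) with hg
  have hder : HasDerivAt g (∑ i, p i * (-Real.log (p i) - c)) 0 := by
    have : ∀ i ∈ Finset.univ, HasDerivAt (fun l : ℝ => p i * Real.exp (l * (-Real.log (p i) - c)))
        (p i * (-Real.log (p i) - c)) 0 := by
      intro i _
      have h1 : HasDerivAt (fun l : ℝ => l * (-Real.log (p i) - c)) (-Real.log (p i) - c) 0 :=
        hasDerivAt_mul_const _
      simpa using (h1.exp.const_mul (p i))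
    exact HasDerivAt.fun_sum this
  have hneg : ∑ i, p i * (-Real.log (p i) - c) < 0 := by
    have : ∑ i, p i * (-Real.log (p i) - c) = -∑ i, p i * Real.log (p i) - (∑ i, p i) * c := by
      rw [Finset.sum_mul, ← Finset.sum_neg_distrib, ← Finset.sum_sub_distrib]
      exact Finset.sum_congr rfl fun i _ => by ring
    rw [this, hsum]; linarith
  have hg0 : g 0 = 1 := by simp [hg, hsum]
  have hev : ∀ᶠ l in nhdsWithin (0 : ℝ) (Set.Ioi 0), slope g 0 l < 0 :=
    ((hasDerivAt_iff_tendsto_slope.1 hder).mono_left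
      (nhdsWithin_mono _ fun x hx => ne_of_gt hx)).eventually (gt_mem_nhds hneg)
  have hev2 : ∀ᶠ l in nhdsWithin (0 : ℝ) (Set.Ioi 0), l ∈ Set.Ioc (0 : ℝ) 1 :=
    Ioc_mem_nhdsGT one_pos
  obtain ⟨l, hl, hl0, hl1⟩ := (hev.and hev2).exists
  refine ⟨l, hl0, hl1, ?_⟩
  have hgl : g l < 1 := by
    rw [slope_def_field, sub_zero, hg0] at hl
    have := (div_neg_iff.1 hl).resolve_left (fun h => absurd h.2 (not_lt.2 hl0.le))
    linarith [this.1]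
  convert hgl using 1
  rw [hg, Finset.mul_sum]
  refine Finset.sum_congr rfl fun i _ => ?_
  rw [mul_left_comm, ← Real.exp_add]
  ring_nf

/-! ### Characters of bit strings -/

instance charP_fin_two : CharP (Fin 2) 2 := inferInstanceAs (CharP (ZMod 2) 2)

theorem bits_add_self {ι : Type*} (u : ι → Fin 2) : u + u = 0 :=
  funext fun i => CharTwo.add_self_eq_zero (u i)

/-- The nontrivial character `a ↦ (-1) ^ a` of `ℤ/2`, with `ℤ/2` encoded as `Fin 2`. -/
def signChar (a : Fin 2) : ℂ := if a = 0 then 1 else -1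

theorem signChar_zero : signChar 0 = 1 := rfl

theorem signChar_add (a b : Fin 2) : signChar (a + b) = signChar a * signChar b := by
  fin_cases a <;> fin_cases b <;> simp [signChar]

theorem star_signChar (a : Fin 2) : star (signChar a) = signChar a := by
  fin_cases a <;> simp [signChar]

theorem signChar_sum {ι : Type*} (s : Finset ι) (f : ι → Fin 2) :
    signChar (∑ i ∈ s, f i) = ∏ i ∈ s, signChar (f i) := by
  classical
  induction s using Finset.induction_on with
  | empty => simp [signChar]
  | insert a s ha ih => rw [Finset.sum_insert ha, Finset.prod_insert ha, signChar_add, ih]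

/-- Orthogonality of the characters of `(ℤ/2)ᵏ`. -/
theorem sum_signChar_dotProduct {k : ℕ} (h : Fin k → Fin 2) :
    ∑ s : Fin k → Fin 2, signChar (s ⬝ᵥ h) = if h = 0 then 2 ^ k else 0 := by
  have h1 : ∑ s : Fin k → Fin 2, signChar (s ⬝ᵥ h) = ∏ i, ∑ a : Fin 2, signChar (a * h i) := by
    rw [Finset.prod_univ_sum, Fintype.piFinset_univ]
    exact Finset.sum_congr rfl fun s _ => signChar_sum _ _
  have h2 : ∀ b : Fin 2, ∑ a : Fin 2, signChar (a * b) = if b = 0 then 2 else 0 := by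
    intro b; fin_cases b <;> norm_num [signChar]
  rw [h1]
  simp only [h2]
  split_ifs with h0
  · simp [h0]
  · obtain ⟨i, hi⟩ := Function.ne_iff.1 h0
    exact Finset.prod_eq_zero (Finset.mem_univ i) (if_neg hi)

/-! ### Syndromes and their collisions -/

/-- The first `k` bits of a string of `k + m` bits: those that get measured. -/
def headBits (u : Fin (k + m) → Fin 2) : Fin k → Fin 2 := fun i => u (Fin.castAdd m i)

/-- The last `m` bits of a string of `k + m` bits: those that are kept. -/
def tailBits (u : Fin (k + m) → Fin 2) : Fin m → Fin 2 := fun i => u (Fin.natAdd k i)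

theorem dotProduct_head_tail (z u : Fin (k + m) → Fin 2) :
    z ⬝ᵥ u = headBits z ⬝ᵥ headBits u + tailBits z ⬝ᵥ tailBits u := by
  simp [dotProduct, Fin.sum_univ_add, headBits, tailBits]

theorem ext_head_tail {u v : Fin (k + m) → Fin 2} (h1 : headBits u = headBits v)
    (h2 : tailBits u = tailBits v) : u = v := by
  funext i
  exact Fin.addCases (fun j => congrFun h1 j) (fun j => congrFun h2 j) i

/-- The last `m` bits of `u` after controlled-NOT gates, laid out by `R`, from the first `k` bits
onto the last `m` bits. -/
def sheared (R : Matrix (Fin k) (Fin m) (Fin 2)) (u : Fin (k + m) → Fin 2) : Fin m → Fin 2 :=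
  tailBits u + headBits u ᵥ* R

theorem sheared_add (R : Matrix (Fin k) (Fin m) (Fin 2)) (u v : Fin (k + m) → Fin 2) :
    sheared R (u + v) = sheared R u + sheared R v := by
  have h1 : tailBits (u + v) = tailBits u + tailBits v := rfl
  have h2 : headBits (u + v) = headBits u + headBits v := rfl
  rw [sheared, sheared, sheared, h1, h2, Matrix.add_vecMul]
  abel

/-- The action on the first `k` bits of the map dual to `sheared`: `k` parities of `z`, given by the
parity-check matrix `[1 | R]`. -/
def parity (R : Matrix (Fin k) (Fin m) (Fin 2)) (z : Fin (k + m) → Fin 2) : Fin k → Fin 2 :=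
  headBits z + R *ᵥ tailBits z

/-- Duality of the basis change `u ↦ (headBits u, sheared R u)` and `z ↦ (parity R z, tailBits z)`.
The two terms containing `R` cancel in characteristic two. -/
theorem dotProduct_eq_parity_sheared (R : Matrix (Fin k) (Fin m) (Fin 2))
    (z u : Fin (k + m) → Fin 2) :
    z ⬝ᵥ u = parity R z ⬝ᵥ headBits u + tailBits z ⬝ᵥ sheared R u := by
  have h : (R *ᵥ tailBits z) ⬝ᵥ headBits u = tailBits z ⬝ᵥ (headBits u ᵥ* R) := by
    rw [dotProduct_comm, Matrix.dotProduct_mulVec, dotProduct_comm]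
  rw [dotProduct_head_tail, parity, sheared, add_dotProduct, dotProduct_add, h]
  linear_combination -(CharTwo.add_self_eq_zero (tailBits z ⬝ᵥ (headBits u ᵥ* R)))

/-- The phase pattern of the Bell string with bit pattern `x` and phase pattern `z`, after both
parties have applied the diagonal unitary `|u⟩ ↦ (-1) ^ (u ⬝ᵥ A *ᵥ u) |u⟩`. -/
def twisted {n : ℕ} (A : Matrix (Fin n) (Fin n) (Fin 2)) (x z : Fin n → Fin 2) : Fin n → Fin 2 :=
  z + (A + Aᵀ) *ᵥ x

theorem quad_add {n : ℕ} (A : Matrix (Fin n) (Fin n) (Fin 2)) (u x : Fin n → Fin 2) :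
    (u + x) ⬝ᵥ A *ᵥ (u + x) = u ⬝ᵥ A *ᵥ u + x ⬝ᵥ A *ᵥ x + ((A + Aᵀ) *ᵥ x) ⬝ᵥ u := by
  have h : x ⬝ᵥ A *ᵥ u = u ⬝ᵥ Aᵀ *ᵥ x := by
    rw [Matrix.dotProduct_mulVec, dotProduct_comm, Matrix.mulVec_transpose]
  rw [Matrix.mulVec_add, add_dotProduct, dotProduct_add, dotProduct_add, h, Matrix.add_mulVec,
    dotProduct_comm (_ + _) u, dotProduct_add]
  ring

/-- The `k` parities revealed by the measurement: those of the twisted phase pattern. Only the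
symmetric part `A + Aᵀ` enters, which over `ℤ/2` has zero diagonal. -/
def syndrome (R : Matrix (Fin k) (Fin m) (Fin 2)) (A : Matrix (Fin (k + m)) (Fin (k + m)) (Fin 2))
    (x z : Fin (k + m) → Fin 2) : Fin k → Fin 2 :=
  parity R (twisted A x z)

theorem parity_add (R : Matrix (Fin k) (Fin m) (Fin 2)) (u v : Fin (k + m) → Fin 2) :
    parity R (u + v) = parity R u + parity R v := by
  have h1 : tailBits (u + v) = tailBits u + tailBits v := rfl
  have h2 : headBits (u + v) = headBits u + headBits v := rfl
  rw [parity, parity, parity, h1, h2, Matrix.mulVec_add]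
  abel

theorem syndrome_add (R : Matrix (Fin k) (Fin m) (Fin 2))
    (A : Matrix (Fin (k + m)) (Fin (k + m)) (Fin 2)) (x z x' z' : Fin (k + m) → Fin 2) :
    syndrome R A (x + x') (z + z') = syndrome R A x z + syndrome R A x' z' := by
  rw [syndrome, syndrome, syndrome, ← parity_add, twisted, twisted, twisted, Matrix.mulVec_add]
  congr 1
  abel

/-- The string `y` followed by `m` zeros. -/
def padZero (y : Fin k → Fin 2) : Fin (k + m) → Fin 2 := Fin.append y 0

theorem parity_padZero (R : Matrix (Fin k) (Fin m) (Fin 2)) (y : Fin k → Fin 2) :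
    parity R (padZero y) = y := by
  have h1 : headBits (padZero (m := m) y) = y := by funext i; simp [headBits, padZero]
  have h2 : tailBits (padZero (m := m) y) = 0 := by funext i; simp [tailBits, padZero]
  rw [parity, h1, h2, Matrix.mulVec_zero, add_zero]

theorem fin_two_eq_one {a : Fin 2} (h : a ≠ 0) : a = 1 := by omega

theorem parity_smul (R : Matrix (Fin k) (Fin m) (Fin 2)) (a : Fin 2) (u : Fin (k + m) → Fin 2) :
    parity R (a • u) = a • parity R u := by
  have h1 : tailBits (a • u) = a • tailBits u := rfl
  have h2 : headBits (a • u) = a • headBits u := rfl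
  rw [parity, parity, h1, h2, Matrix.mulVec_smul, smul_add]

/-- The effect on the syndrome of adding a rank-one matrix to `A`. Up to a multiple of one fixed
vector, every change `y` of the syndrome can be achieved in this way, as soon as `x ≠ 0`. -/
theorem syndrome_add_vecMulVec (R : Matrix (Fin k) (Fin m) (Fin 2))
    (A : Matrix (Fin (k + m)) (Fin (k + m)) (Fin 2)) (x z : Fin (k + m) → Fin 2)
    {i : Fin (k + m)} (hi : x i = 1) (y : Fin k → Fin 2) :
    syndrome R (A + Matrix.vecMulVec (padZero y) (Pi.single i 1)) x z
      = syndrome R A x z + y + (padZero y ⬝ᵥ x) • parity R (Pi.single i 1) := by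
  have h : twisted (A + Matrix.vecMulVec (padZero y) (Pi.single i 1)) x z
      = twisted A x z + padZero y + (padZero y ⬝ᵥ x) • Pi.single i 1 := by
    have h1 : Matrix.vecMulVec (padZero (m := m) y) (Pi.single i 1) *ᵥ x = padZero y := by
      rw [Matrix.vecMulVec_mulVec]; simp [hi]
    have h2 : (Matrix.vecMulVec (padZero y) (Pi.single i 1))ᵀ *ᵥ x
        = (padZero y ⬝ᵥ x) • Pi.single i 1 := by
      rw [Matrix.transpose_vecMulVec, Matrix.vecMulVec_mulVec]; simp
    rw [twisted, twisted, Matrix.transpose_add, Matrix.add_mulVec, Matrix.add_mulVec,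
      Matrix.add_mulVec, Matrix.add_mulVec, h1, h2]
    abel
  rw [syndrome, h, parity_add, parity_add, parity_smul, parity_padZero, syndrome]

open Classical in
/-- For fixed `(x, z) ≠ 0` the syndrome vanishes with probability at most `2 / 2 ^ k` over uniformly
random `R` and `A`. Parameters with vanishing syndrome, paired with a string `y` of `k` bits, are
mapped injectively to parameters paired with one bit: shift the syndrome by `y`, changing `A` if
`x ≠ 0` and `R` otherwise. The additional bit makes up for the vector that `A + Aᵀ` cannot control. -/
theorem card_syndrome_eq_zero_le {x z : Fin (k + m) → Fin 2} (hxz : x ≠ 0 ∨ z ≠ 0) :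
    (Finset.univ.filter fun θ : Matrix (Fin k) (Fin m) (Fin 2) ×
        Matrix (Fin (k + m)) (Fin (k + m)) (Fin 2) => syndrome θ.1 θ.2 x z = 0).card * 2 ^ k
      ≤ Fintype.card (Matrix (Fin k) (Fin m) (Fin 2) ×
        Matrix (Fin (k + m)) (Fin (k + m)) (Fin 2)) * 2 := by
  set S := Finset.univ.filter fun θ : Matrix (Fin k) (Fin m) (Fin 2) ×
        Matrix (Fin (k + m)) (Fin (k + m)) (Fin 2) => syndrome θ.1 θ.2 x z = 0 with hS
  have hmem : ∀ θ : S, syndrome θ.1.1 θ.1.2 x z = 0 := fun θ => (Finset.mem_filter.1 θ.2).2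
  have hcard : Fintype.card (S × (Fin k → Fin 2)) = S.card * 2 ^ k := by simp
  have hcard' : ∀ α : Type, [Fintype α] → Fintype.card (α × Fin 2) = Fintype.card α * 2 := by
    intro α _; simp
  rw [← hcard, ← hcard']
  by_cases hx : x = 0
  -- no bit errors: `R` randomizes the parities, unless the kept phases vanish, and then there is
  -- no parameter with vanishing syndrome
  · have hz : z ≠ 0 := hxz.resolve_left (not_not.2 hx)
    subst hx
    have hsyn : ∀ R A, syndrome (k := k) (m := m) R A 0 z = headBits z + R *ᵥ tailBits z := by
      intro R A; simp [syndrome, twisted, parity]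
    by_cases ht : tailBits z = 0
    · have hh : headBits z ≠ 0 := fun hh => hz (ext_head_tail hh ht)
      have : IsEmpty S := ⟨fun θ => hh (by have := hmem θ; rwa [hsyn, ht, Matrix.mulVec_zero,
        add_zero] at this)⟩
      simp
    · obtain ⟨j, hj⟩ := Function.ne_iff.1 ht
      have hj1 : tailBits z j = 1 := fin_two_eq_one hj
      refine Fintype.card_le_of_injective (fun a : S × (Fin k → Fin 2) =>
        ((a.1.1.1 + Matrix.vecMulVec a.2 (Pi.single j 1), a.1.1.2), (0 : Fin 2))) ?_
      rintro ⟨θ, y⟩ ⟨θ', y'⟩ hab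
      simp only [Prod.mk.injEq, and_true] at hab
      obtain ⟨h1, h2⟩ := hab
      have hy : ∀ (θ : S) y, headBits z + (θ.1.1 + Matrix.vecMulVec y (Pi.single j 1)) *ᵥ tailBits z
          = y := by
        intro θ y
        have := hmem θ
        rw [hsyn] at this
        rw [Matrix.add_mulVec, ← add_assoc, this, Matrix.vecMulVec_mulVec]
        simp [hj1]
      have hyy : y = y' := by rw [← hy θ y, ← hy θ' y', h1]
      subst hyy
      have : θ = θ' := Subtype.ext (Prod.ext (add_right_cancel h1) h2)
      rw [this]
  -- some bit error: `A` randomizes the phases, and the extra bit is the coefficient of the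
  -- uncontrolled vector `parity R (Pi.single i 1)`
  · obtain ⟨i, hi⟩ := Function.ne_iff.1 hx
    have hi1 : x i = 1 := fin_two_eq_one hi
    refine Fintype.card_le_of_injective (fun a : S × (Fin k → Fin 2) =>
        ((a.1.1.1, a.1.1.2 + Matrix.vecMulVec (padZero a.2) (Pi.single i 1)),
          padZero a.2 ⬝ᵥ x)) ?_
    rintro ⟨θ, y⟩ ⟨θ', y'⟩ hab
    simp only [Prod.mk.injEq] at hab
    obtain ⟨⟨h1, h2⟩, h3⟩ := hab
    have e1 := syndrome_add_vecMulVec θ.1.1 θ.1.2 x z hi1 y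
    have e2 := syndrome_add_vecMulVec θ'.1.1 θ'.1.2 x z hi1 y'
    rw [hmem, zero_add] at e1 e2
    rw [h1, h2, e2, h3] at e1
    have hyy : y' = y := add_right_cancel e1
    subst hyy
    have : θ = θ' := Subtype.ext (Prod.ext h1 (add_right_cancel h2))
    rw [this]

/-! ### Functional calculus on eigenvectors -/

/-- The continuous functional calculus acts on eigenvectors through the eigenvalue. On the finite
spectrum the function agrees with an interpolating polynomial. -/
theorem cfc_mulVec_of_mulVec_eq {ι : Type*} [Fintype ι] [DecidableEq ι] {A : Matrix ι ι ℂ}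
    (hA : A.IsHermitian) (f : ℝ → ℝ) {v : ι → ℂ} {c : ℝ} (hv : A *ᵥ v = (c : ℂ) • v) :
    cfc f A *ᵥ v = (f c : ℂ) • v := by
  classical
  have hfin : (spectrum ℝ A).Finite := Matrix.finite_real_spectrum
  set nodes := insert c hfin.toFinset with hnodes
  set q := Lagrange.interpolate nodes id f with hq
  have hqe : ∀ x ∈ nodes, q.eval x = f x := fun x hx =>
    Lagrange.eval_interpolate_at_node (v := id) f (Function.injective_id.injOn) hx
  have h1 : cfc f A = Polynomial.aeval A q := by
    rw [← cfc_polynomial q A hA.isSelfAdjoint]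
    exact cfc_congr fun x hx => (hqe x (by simp [hnodes, hx])).symm
  have hpow : ∀ j : ℕ, (A ^ j) *ᵥ v = ((c ^ j : ℝ) : ℂ) • v := by
    intro j
    induction j with
    | zero => simp
    | succ j ih =>
      rw [pow_succ, ← Matrix.mulVec_mulVec, hv, Matrix.mulVec_smul, ih, smul_smul]
      push_cast
      ring_nf
  have h2 : ∀ r : Polynomial ℝ, Polynomial.aeval A r *ᵥ v = ((r.eval c : ℝ) : ℂ) • v := by
    intro r
    induction r using Polynomial.induction_on' with
    | add r s hr hs => rw [map_add, Matrix.add_mulVec, hr, hs, Polynomial.eval_add, ← add_smul,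
        Complex.ofReal_add]
    | monomial j a =>
      rw [Polynomial.aeval_monomial, ← Algebra.smul_def, Matrix.smul_mulVec, hpow,
        Polynomial.eval_monomial, Complex.ofReal_mul, mul_smul]
      rfl
  rw [h1, h2, hqe c (by simp [hnodes])]

/-! ### Bell vectors -/

/-- The bit pattern of a Bell vector: `1` for `Ψ⁺`, `Ψ⁻`. -/
def bellX : Fin 4 → Fin 2 := ![0, 1, 0, 1]
/-- The phase pattern of a Bell vector: `1` for `Φ⁻`, `Ψ⁻`. -/
def bellZ : Fin 4 → Fin 2 := ![0, 0, 1, 1]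

theorem bell_ext : ∀ {a b : Fin 4}, bellX a = bellX b → bellZ a = bellZ b → a = b := by
  decide

theorem bellVec_apply (e : Fin 4) (a b : Fin 2) :
    bellVec e (a, b)
      = if b = a + bellX e then ((√2 : ℝ) : ℂ)⁻¹ * signChar (bellZ e * a) else 0 := by
  fin_cases e <;> fin_cases a <;> fin_cases b <;>
    simp [bellVec, ket, bellX, bellZ, signChar]

theorem sqrt_two_inv_sq : (((√2 : ℝ) : ℂ)⁻¹) ^ 2 = 2⁻¹ := by
  rw [inv_pow, ← Complex.ofReal_pow, Real.sq_sqrt (by norm_num)]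
  norm_num

theorem bellVec_orthonormal (x y : Fin 4) :
    star (bellVec x) ⬝ᵥ bellVec y = if x = y then 1 else 0 := by
  have h := sqrt_two_inv_sq
  rw [sq] at h
  fin_cases x <;> fin_cases y <;>
    simp [dotProduct, Fintype.sum_prod_type, bellVec_apply, bellX, bellZ, signChar, h] <;> norm_num

/-! ### Rank-one operators -/

theorem proj_mulVec {ι : Type*} [Fintype ι] (φ ψ : ι → ℂ) :
    proj φ *ᵥ ψ = (star φ ⬝ᵥ ψ) • φ := by
  rw [proj, Matrix.vecMulVec_mulVec]
  funext i
  simp [mul_comm]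

theorem trace_proj_mul {ι : Type*} [Fintype ι] (φ : ι → ℂ) (B : Matrix ι ι ℂ) :
    (proj φ * B).trace = star φ ⬝ᵥ B *ᵥ φ := by
  rw [proj, Matrix.vecMulVec_mul, Matrix.trace_vecMulVec, dotProduct_comm,
    Matrix.dotProduct_mulVec]

theorem conjBy_proj {ι κ : Type*} [Fintype ι] (K : Matrix κ ι ℂ) (ψ : ι → ℂ) :
    conjBy K (proj ψ) = proj (K *ᵥ ψ) := by
  change K * proj ψ * Kᴴ = _
  rw [proj, proj, Matrix.mul_vecMulVec, Matrix.vecMulVec_mul, Matrix.star_mulVec]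

theorem trace_proj_mul_proj {ι : Type*} [Fintype ι] (φ ψ : ι → ℂ) :
    (proj φ * proj ψ).trace = (Complex.normSq (star φ ⬝ᵥ ψ) : ℂ) := by
  rw [trace_proj_mul, proj_mulVec, dotProduct_smul, smul_eq_mul, Complex.normSq_eq_conj_mul_self,
    starRingEnd_apply, ← Matrix.star_dotProduct]

theorem conjBy_mul {ι κ l : Type*} [Fintype ι] [Fintype κ] (K : Matrix l κ ℂ) (K' : Matrix κ ι ℂ) :
    conjBy K ∘ₗ conjBy K' = conjBy (K * K') := by
  ext1 X
  change K * (K' * X * K'ᴴ) * Kᴴ = (K * K') * X * (K * K')ᴴ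
  rw [Matrix.conjTranspose_mul]
  simp only [Matrix.mul_assoc]

/-! ### Bell-diagonal states -/

/-- The coefficients of a Bell-diagonal state form a probability distribution, and its von Neumann
entropy is the Shannon entropy of that distribution. -/
theorem exists_spectrum_of_isBellDiagonalState
    {ρ : Matrix (Fin 2 × Fin 2) (Fin 2 × Fin 2) ℂ} (hρ : IsBellDiagonalState ρ) :
    ∃ p : Fin 4 → ℝ, (∀ x, 0 ≤ p x) ∧ ∑ x, p x = 1 ∧
      ρ = ∑ x, (p x : ℂ) • proj (bellVec x) ∧
      entropy ρ = -∑ x, p x * Real.logb 2 (p x) := by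
  obtain ⟨⟨hpos, htr⟩, c, hc⟩ := hρ
  have hmul : ∀ x, ρ *ᵥ bellVec x = c x • bellVec x := by
    intro x
    rw [hc, Matrix.sum_mulVec, Finset.sum_eq_single x]
    · rw [Matrix.smul_mulVec, proj_mulVec, bellVec_orthonormal, if_pos rfl, one_smul]
    · intro y _ hy
      rw [Matrix.smul_mulVec, proj_mulVec, bellVec_orthonormal, if_neg hy, zero_smul, smul_zero]
    · simp
  have hc0 : ∀ x, 0 ≤ c x := by
    intro x
    have := hpos.dotProduct_mulVec_nonneg (bellVec x)
    rwa [hmul, dotProduct_smul, bellVec_orthonormal, if_pos rfl, smul_eq_mul, mul_one] at this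
  have hre : ∀ x, c x = ((c x).re : ℂ) := fun x => Complex.eq_re_of_ofReal_le (hc0 x)
  have htrace : ∀ B, (ρ * B).trace = ∑ x, c x * (star (bellVec x) ⬝ᵥ B *ᵥ bellVec x) := by
    intro B
    conv_lhs => rw [hc]
    rw [Finset.sum_mul, Matrix.trace_sum]
    refine Finset.sum_congr rfl fun x _ => ?_
    rw [Matrix.smul_mul, Matrix.trace_smul, trace_proj_mul, smul_eq_mul]
  refine ⟨fun x => (c x).re, fun x => (Complex.le_def.1 (hc0 x)).1, ?_, ?_, ?_⟩
  · have := htrace 1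
    rw [mul_one, htr] at this
    simp only [Matrix.one_mulVec, bellVec_orthonormal, if_true, mul_one] at this
    simpa using (congrArg Complex.re this).symm
  · rw [hc]
    exact Finset.sum_congr rfl fun x _ => by rw [← hre]
  · rw [entropy, htrace, Complex.re_sum]
    congr 1
    refine Finset.sum_congr rfl fun x _ => ?_
    have hv : ρ *ᵥ bellVec x = ((c x).re : ℂ) • bellVec x := by rw [← hre, hmul]
    rw [cfc_mulVec_of_mulVec_eq hpos.1 (Real.logb 2) hv, dotProduct_smul, bellVec_orthonormal,
      if_pos rfl, smul_eq_mul, mul_one, Complex.re_mul_ofReal]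

/-- The product of `n` Bell vectors with bit pattern `x` and phase pattern `z`, regrouped into
Alice's `n` qubits and Bob's `n` qubits. -/
noncomputable def bellProd {n : ℕ} (x z : Fin n → Fin 2) :
    (Fin n → Fin 2) × (Fin n → Fin 2) → ℂ := fun w =>
  if w.2 = w.1 + x then (((√2 : ℝ) : ℂ)⁻¹) ^ n * signChar (z ⬝ᵥ w.1) else 0

theorem prod_bellVec {n : ℕ} (e : Fin n → Fin 4) (w : (Fin n → Fin 2) × (Fin n → Fin 2)) :
    ∏ i, bellVec (e i) (w.1 i, w.2 i)
      = bellProd (fun i => bellX (e i)) (fun i => bellZ (e i)) w := by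
  rw [bellProd]
  split_ifs with h
  · rw [dotProduct, signChar_sum, ← Fin.prod_const, ← Finset.prod_mul_distrib]
    refine Finset.prod_congr rfl fun i _ => ?_
    rw [bellVec_apply]
    exact if_pos (congrFun h i)
  · obtain ⟨i, hi⟩ := Function.ne_iff.1 h
    refine Finset.prod_eq_zero (Finset.mem_univ i) ?_
    rw [bellVec_apply]
    exact if_neg hi

theorem tensorPow_sum_proj_bellVec (p : Fin 4 → ℂ) (n : ℕ) :
    tensorPow (∑ x, p x • proj (bellVec x)) n = ∑ e : Fin n → Fin 4, (∏ i, p (e i)) •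
      proj (bellProd (fun i => bellX (e i)) (fun i => bellZ (e i))) := by
  ext u v
  simp only [tensorPow, Matrix.of_apply, Matrix.sum_apply, Matrix.smul_apply, proj,
    Matrix.vecMulVec_apply, Pi.star_apply, smul_eq_mul]
  rw [Finset.prod_univ_sum, Fintype.piFinset_univ]
  refine Finset.sum_congr rfl fun e _ => ?_
  rw [Finset.prod_mul_distrib, Finset.prod_mul_distrib, ← prod_bellVec, ← prod_bellVec, star_prod]

theorem tensorPow_sigmaPlus (m : ℕ) : tensorPow sigmaPlus m = proj (bellProd 0 0) := by
  ext u v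
  simp only [tensorPow, sigmaPlus, Matrix.of_apply, proj, Matrix.vecMulVec_apply, Pi.star_apply]
  rw [Finset.prod_mul_distrib, ← star_prod, prod_bellVec (fun _ => 0), prod_bellVec (fun _ => 0)]
  rfl

/-! ### The measurement of the syndrome -/

/-- The Kraus operators of a party's measurement, with outcome `s`: apply the diagonal unitary
`(-1) ^ (u ⬝ᵥ A *ᵥ u)` and the controlled-NOT gates of `R`, measure the first `k` qubits in the
`X` basis, and apply to the remaining `m` qubits the Pauli operator that shifts bits by `cx` and then
flips phases by `cz`. -/
noncomputable def codeKraus (R : Matrix (Fin k) (Fin m) (Fin 2))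
    (A : Matrix (Fin (k + m)) (Fin (k + m)) (Fin 2)) (cx cz : Fin m → Fin 2) (s : Fin k → Fin 2) :
    Matrix (Fin m → Fin 2) (Fin (k + m) → Fin 2) ℂ :=
  Matrix.of fun w u => if w = sheared R u + cx then
    (((√2 : ℝ) : ℂ)⁻¹) ^ k * signChar (s ⬝ᵥ headBits u + u ⬝ᵥ A *ᵥ u + cz ⬝ᵥ w) else 0

theorem star_sqrt_two_inv_pow (k : ℕ) :
    star ((((√2 : ℝ) : ℂ)⁻¹) ^ k) = (((√2 : ℝ) : ℂ)⁻¹) ^ k := by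
  simp

/-- Completeness holds also if the final Pauli correction depends on the outcome `s`. -/
theorem sum_conjTranspose_codeKraus_mul (R : Matrix (Fin k) (Fin m) (Fin 2))
    (A : Matrix (Fin (k + m)) (Fin (k + m)) (Fin 2)) (cx cz : (Fin k → Fin 2) → Fin m → Fin 2) :
    ∑ s, (codeKraus R A (cx s) (cz s) s)ᴴ * codeKraus R A (cx s) (cz s) s = 1 := by
  ext u v
  rw [Matrix.sum_apply]
  -- only the output `w = sheared R u + cx s` contributes, and there the correction phase cancels
  have hterm : ∀ s, ((codeKraus R A (cx s) (cz s) s)ᴴ * codeKraus R A (cx s) (cz s) s) u v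
      = if sheared R u = sheared R v then 2⁻¹ ^ k * (signChar (u ⬝ᵥ A *ᵥ u + v ⬝ᵥ A *ᵥ v)
        * signChar (s ⬝ᵥ (headBits u + headBits v))) else 0 := by
    intro s
    rw [Matrix.mul_apply, Finset.sum_eq_single (sheared R u + cx s)]
    · simp only [Matrix.conjTranspose_apply, codeKraus, Matrix.of_apply, if_true,
        add_left_inj, mul_ite, mul_zero]
      refine if_congr Iff.rfl ?_ rfl
      rw [star_mul', star_sqrt_two_inv_pow, star_signChar, mul_mul_mul_comm, ← pow_add, ← two_mul,
        pow_mul, sqrt_two_inv_sq, ← signChar_add, ← signChar_add, dotProduct_add s]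
      congr 2
      linear_combination
        CharTwo.add_self_eq_zero (cz s ⬝ᵥ (sheared R u + cx s))
    · intro w _ hw
      simp [Matrix.conjTranspose_apply, codeKraus, hw]
    · simp
  simp only [hterm]
  by_cases huv : u = v
  · subst huv
    have h0 : headBits u + headBits u = 0 := bits_add_self _
    have h1 : u ⬝ᵥ A *ᵥ u + u ⬝ᵥ A *ᵥ u = 0 := CharTwo.add_self_eq_zero _
    simp [h0, h1, signChar_zero]
  · rw [Matrix.one_apply_ne huv]
    by_cases hs : sheared R u = sheared R v
    · have hh : headBits u + headBits v ≠ 0 := by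
        intro hh
        have hh' : headBits u = headBits v := by
          rw [← sub_eq_zero, ← hh, sub_eq_iff_eq_add, add_assoc, bits_add_self, add_zero]
        refine huv (ext_head_tail hh' ?_)
        rw [sheared, sheared, hh'] at hs
        exact add_right_cancel hs
      simp only [hs, if_true]
      rw [← Finset.mul_sum, ← Finset.mul_sum, sum_signChar_dotProduct, if_neg hh, mul_zero,
        mul_zero]
    · simp [hs]

/-- If the outcomes of Alice and Bob differ by the syndrome of the Bell string `(x, z)`, and Bob
corrects for that string, the overlap of the outcome with `m` copies of `Φ⁺` has squared modulus
`2 ^ (-k)`: all phases that depend on the summation variable cancel. Each of Alice's `2 ^ k` outcomes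
thus contributes `2 ^ (-k)`, with one outcome of Bob. -/
theorem normSq_overlap_codeKraus (R : Matrix (Fin k) (Fin m) (Fin 2))
    (A : Matrix (Fin (k + m)) (Fin (k + m)) (Fin 2)) (x z : Fin (k + m) → Fin 2)
    (s : Fin k → Fin 2) :
    Complex.normSq (star (bellProd 0 0) ⬝ᵥ
      (codeKraus R A 0 0 s ⊗ₖ codeKraus R A (sheared R x) (tailBits (twisted A x z))
        (s + syndrome R A x z)) *ᵥ bellProd x z) = ((2 : ℝ) ^ k)⁻¹ := by
  set b : ℂ := ((√2 : ℝ) : ℂ)⁻¹ with hb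
  set h := syndrome R A x z with hh
  set t := tailBits (twisted A x z) with ht
  set c : Fin 2 := s ⬝ᵥ headBits x + h ⬝ᵥ headBits x + x ⬝ᵥ A *ᵥ x with hc
  have hxx : sheared R x + sheared R x = 0 := bits_add_self _
  -- the total phase exponent of the term `u` does not depend on `u`
  have hphase : ∀ u, (s ⬝ᵥ headBits u + u ⬝ᵥ A *ᵥ u + 0 ⬝ᵥ sheared R u)
      + ((s + h) ⬝ᵥ headBits (u + x) + (u + x) ⬝ᵥ A *ᵥ (u + x) + t ⬝ᵥ sheared R u)
      + z ⬝ᵥ u = c := by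
    intro u
    have h1 : twisted A x z ⬝ᵥ u = h ⬝ᵥ headBits u + t ⬝ᵥ sheared R u :=
      dotProduct_eq_parity_sheared R _ u
    rw [twisted, add_dotProduct] at h1
    have h2 : headBits (u + x) = headBits u + headBits x := rfl
    rw [quad_add, h2, dotProduct_add, add_dotProduct, add_dotProduct, zero_dotProduct, hc]
    linear_combination h1 + CharTwo.add_self_eq_zero (s ⬝ᵥ headBits u)
      + CharTwo.add_self_eq_zero (u ⬝ᵥ A *ᵥ u) + CharTwo.add_self_eq_zero (h ⬝ᵥ headBits u)
      + CharTwo.add_self_eq_zero (t ⬝ᵥ sheared R u)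
  have hchar : ∀ a b d : Fin 2, a + b + d = c → signChar c = signChar a * signChar b * signChar d :=
    fun a b d habd => by rw [← habd, signChar_add, signChar_add]
  have hmulVec : ∀ w : (Fin m → Fin 2) × (Fin m → Fin 2),
      ((codeKraus R A 0 0 s ⊗ₖ codeKraus R A (sheared R x) t (s + h)) *ᵥ bellProd x z) w
        = ∑ u, codeKraus R A 0 0 s w.1 u * codeKraus R A (sheared R x) t (s + h) w.2 (u + x)
          * (b ^ (k + m) * signChar (z ⬝ᵥ u)) := by
    intro w
    rw [Matrix.mulVec, dotProduct, Fintype.sum_prod_type]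
    refine Finset.sum_congr rfl fun u _ => ?_
    rw [Finset.sum_eq_single (u + x)]
    · simp [bellProd, hb]
    · intro v _ hv
      simp [bellProd, hv]
    · simp
  have hval : star (bellProd 0 0) ⬝ᵥ
      (codeKraus R A 0 0 s ⊗ₖ codeKraus R A (sheared R x) t (s + h)) *ᵥ bellProd x z
      = 2 ^ (k + m) * (b ^ m * (b ^ k * b ^ k * b ^ (k + m))) * signChar c := by
    have h1 : star (bellProd 0 0) ⬝ᵥ
      (codeKraus R A 0 0 s ⊗ₖ codeKraus R A (sheared R x) t (s + h)) *ᵥ bellProd x z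
      = ∑ w, ∑ u, b ^ m * (codeKraus R A 0 0 s w u *
          codeKraus R A (sheared R x) t (s + h) w (u + x) * (b ^ (k + m) * signChar (z ⬝ᵥ u))) := by
      rw [dotProduct, Fintype.sum_prod_type]
      refine Finset.sum_congr rfl fun w _ => ?_
      rw [Finset.sum_eq_single w]
      · rw [hmulVec, Finset.mul_sum]
        refine Finset.sum_congr rfl fun u _ => ?_
        simp [bellProd, signChar_zero, hb]
      · intro v _ hv
        simp [bellProd, hv]
      · simp
    rw [h1, Finset.sum_comm]
    have h2 : ∀ u ∈ (Finset.univ : Finset (Fin (k + m) → Fin 2)),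
        ∑ w, b ^ m * (codeKraus R A 0 0 s w u *
          codeKraus R A (sheared R x) t (s + h) w (u + x) * (b ^ (k + m) * signChar (z ⬝ᵥ u)))
        = b ^ m * (b ^ k * b ^ k * b ^ (k + m)) * signChar c := by
      intro u _
      rw [Finset.sum_eq_single (sheared R u)]
      · have e1 : codeKraus R A 0 0 s (sheared R u) u = b ^ k * signChar
            (s ⬝ᵥ headBits u + u ⬝ᵥ A *ᵥ u + 0 ⬝ᵥ sheared R u) := by
          simp [codeKraus, hb]
        have e2 : codeKraus R A (sheared R x) t (s + h) (sheared R u) (u + x) = b ^ k * signChar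
            ((s + h) ⬝ᵥ headBits (u + x) + (u + x) ⬝ᵥ A *ᵥ (u + x) + t ⬝ᵥ sheared R u) := by
          rw [codeKraus, Matrix.of_apply, if_pos]
          rw [sheared_add, add_assoc, hxx, add_zero]
        rw [e1, e2, hchar _ _ _ (hphase u)]
        ring
      · intro w _ hw
        simp [codeKraus, hw]
      · simp
    rw [Finset.sum_congr rfl h2, Finset.sum_const, nsmul_eq_mul]
    simp
    ring
  rw [hval]
  have hnb : Complex.normSq b = 2⁻¹ := by
    rw [hb, Complex.normSq_inv, Complex.normSq_ofReal, Real.mul_self_sqrt (by norm_num)]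
  have hns : Complex.normSq (signChar c) = 1 := by
    unfold signChar; split_ifs <;> simp
  have hn2 : Complex.normSq 2 = 4 := by norm_num [Complex.normSq_apply]
  simp only [map_mul, map_pow, hnb, hns, hn2, mul_one]
  rw [show (4 : ℝ) = 2 * 2 by norm_num, mul_pow]
  simp only [inv_pow, pow_add]
  field_simp

/-- A one-way protocol is LOCC: Alice measures and announces `i`, Bob measures with a Kraus family
that depends on `i`. -/
theorem isLOCC_oneWay {a b o q ι κ : Type} [Fintype a] [DecidableEq a] [Fintype b] [DecidableEq b]
    [Fintype o] [DecidableEq o] [Fintype q] [DecidableEq q] [Fintype ι] [Fintype κ]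
    (K : ι → Matrix o a ℂ) (hK : ∑ i, (K i)ᴴ * K i = 1)
    (L : ι → κ → Matrix q b ℂ) (hL : ∀ i, ∑ j, (L i j)ᴴ * L i j = 1) :
    IsLOCC (∑ i, ∑ j, conjBy (K i ⊗ₖ L i j)) := by
  set eι := (Fintype.equivFin ι).symm
  set eκ := (Fintype.equivFin κ).symm
  have hbob : ∀ i, IsLOCC (∑ j, LinearMap.id ∘ₗ bobMap (a := o) (L i (eκ j))) := fun i =>
    IsLOCC.bob (fun j => L i (eκ j))
      (by rw [IsKraus, eκ.sum_comp (fun j => (L i j)ᴴ * L i j), hL]) _ fun _ => IsLOCC.done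
  have halice := IsLOCC.alice (fun i => K (eι i))
    (by rw [IsKraus, eι.sum_comp (fun i => (K i)ᴴ * K i), hK])
    (fun i => ∑ j, LinearMap.id ∘ₗ bobMap (a := o) (L (eι i) (eκ j))) fun i => hbob (eι i)
  convert halice using 1
  rw [eι.sum_comp (fun i => (∑ j, LinearMap.id ∘ₗ bobMap (a := o) (L i (eκ j))) ∘ₗ aliceMap (K i))]
  refine Finset.sum_congr rfl fun i _ => ?_
  rw [eκ.sum_comp (fun j => LinearMap.id ∘ₗ bobMap (a := o) (L i j))]
  refine LinearMap.ext fun X => ?_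
  rw [LinearMap.comp_apply, LinearMap.sum_apply, LinearMap.sum_apply]
  refine Finset.sum_congr rfl fun j _ => ?_
  have hj : conjBy (K i ⊗ₖ L i j) = bobMap (L i j) ∘ₗ aliceMap (K i) := by
    rw [bobMap, aliceMap, conjBy_mul, ← Matrix.mul_kronecker_mul, Matrix.one_mul, Matrix.mul_one]
  rw [hj]
  rfl

/-! ### Fidelity of the protocol -/

/-- The one-way protocol built from a decoder of the syndrome has fidelity at least the probability
that the decoder finds the Bell string. Outcomes that disagree with the decoder contribute
nonnegatively and are dropped. -/
theorem exists_isLOCC_of_decoder (R : Matrix (Fin k) (Fin m) (Fin 2))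
    (A : Matrix (Fin (k + m)) (Fin (k + m)) (Fin 2)) (dec : (Fin k → Fin 2) → Fin (k + m) → Fin 4)
    (p : Fin 4 → ℝ) (hp : ∀ x, 0 ≤ p x) :
    ∃ Λ : Matrix ((Fin (k + m) → Fin 2) × (Fin (k + m) → Fin 2))
          ((Fin (k + m) → Fin 2) × (Fin (k + m) → Fin 2)) ℂ →ₗ[ℂ]
        Matrix ((Fin m → Fin 2) × (Fin m → Fin 2)) ((Fin m → Fin 2) × (Fin m → Fin 2)) ℂ,
      IsLOCC Λ ∧
      (∑ e : Fin (k + m) → Fin 4,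
        if dec (syndrome R A (fun i => bellX (e i)) (fun i => bellZ (e i))) = e
          then ∏ i, p (e i) else 0)
        ≤ (tensorPow sigmaPlus m *
            Λ (tensorPow (∑ x, (p x : ℂ) • proj (bellVec x)) (k + m))).trace.re := by
  classical
  set X : (Fin (k + m) → Fin 4) → Fin (k + m) → Fin 2 := fun e i => bellX (e i) with hX
  set Z : (Fin (k + m) → Fin 4) → Fin (k + m) → Fin 2 := fun e i => bellZ (e i) with hZ
  -- Bob's correction, determined by the sum `y` of the two announced outcomes
  set cx : (Fin k → Fin 2) → Fin m → Fin 2 := fun y => sheared R (X (dec y)) with hcx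
  set cz : (Fin k → Fin 2) → Fin m → Fin 2 :=
    fun y => tailBits (twisted A (X (dec y)) (Z (dec y))) with hcz
  set B : (Fin k → Fin 2) → (Fin k → Fin 2) → Matrix _ _ ℂ := fun s t =>
    codeKraus R A 0 0 s ⊗ₖ codeKraus R A (cx (s + t)) (cz (s + t)) t with hB
  refine ⟨∑ s, ∑ t, conjBy (B s t),
    isLOCC_oneWay _ (sum_conjTranspose_codeKraus_mul R A 0 0) _
      fun s => sum_conjTranspose_codeKraus_mul R A (fun t => cx (s + t)) (fun t => cz (s + t)), ?_⟩
  have hval : (tensorPow sigmaPlus m *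
      (∑ s, ∑ t, conjBy (B s t)) (tensorPow (∑ x, (p x : ℂ) • proj (bellVec x)) (k + m))).trace.re
      = ∑ e : Fin (k + m) → Fin 4, (∏ i, p (e i)) * ∑ s, ∑ t,
          Complex.normSq (star (bellProd 0 0) ⬝ᵥ B s t *ᵥ bellProd (X e) (Z e)) := by
    rw [tensorPow_sigmaPlus, tensorPow_sum_proj_bellVec, map_sum, Finset.mul_sum,
      Matrix.trace_sum, Complex.re_sum]
    refine Finset.sum_congr rfl fun e _ => ?_
    rw [map_smul, Matrix.mul_smul, Matrix.trace_smul, smul_eq_mul, ← Complex.ofReal_prod,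
      Complex.re_ofReal_mul]
    congr 1
    simp only [LinearMap.sum_apply, Finset.mul_sum, Matrix.trace_sum, Complex.re_sum,
      conjBy_proj, trace_proj_mul_proj, Complex.ofReal_re]
    rfl
  rw [hval]
  refine Finset.sum_le_sum fun e _ => ?_
  have hpe : 0 ≤ ∏ i, p (e i) := Finset.prod_nonneg fun i _ => hp _
  split_ifs with hd
  · refine le_mul_of_one_le_right hpe ?_
    set h := syndrome R A (X e) (Z e) with hh
    have hone : ∑ _s : Fin k → Fin 2, ((2 : ℝ) ^ k)⁻¹ = 1 := by simp
    rw [← hone]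
    refine Finset.sum_le_sum fun s _ => ?_
    have hs : s + (s + h) = h := by rw [← add_assoc, bits_add_self, zero_add]
    refine le_trans (le_of_eq ?_) (Finset.single_le_sum (f := fun t => Complex.normSq
      (star (bellProd 0 0) ⬝ᵥ B s t *ᵥ bellProd (X e) (Z e)))
      (fun t _ => Complex.normSq_nonneg _) (Finset.mem_univ (s + h)))
    rw [← normSq_overlap_codeKraus R A (X e) (Z e) s]
    simp only [hB, hcx, hcz, hs]
    rw [hd]
  · exact mul_nonneg hpe (Finset.sum_nonneg fun s _ => Finset.sum_nonneg fun t _ =>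
      Complex.normSq_nonneg _)

open Classical in
theorem card_syndrome_eq_le {x z x' z' : Fin (k + m) → Fin 2} (h : x ≠ x' ∨ z ≠ z') :
    ((Finset.univ.filter fun θ : Matrix (Fin k) (Fin m) (Fin 2) ×
        Matrix (Fin (k + m)) (Fin (k + m)) (Fin 2) =>
          syndrome θ.1 θ.2 x z = syndrome θ.1 θ.2 x' z').card : ℝ)
      ≤ 2 / 2 ^ k * Fintype.card (Matrix (Fin k) (Fin m) (Fin 2) ×
        Matrix (Fin (k + m)) (Fin (k + m)) (Fin 2)) := by
  have hne : ∀ {a b : Fin (k + m) → Fin 2}, a ≠ b → a + b ≠ 0 := by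
    intro a b hab h0
    exact hab (by rw [← add_zero a, ← bits_add_self b, ← add_assoc, h0, zero_add])
  have hiff : ∀ θ : Matrix (Fin k) (Fin m) (Fin 2) × Matrix (Fin (k + m)) (Fin (k + m)) (Fin 2),
      syndrome θ.1 θ.2 x z = syndrome θ.1 θ.2 x' z' →
        syndrome θ.1 θ.2 (x + x') (z + z') = 0 := by
    intro θ hθ
    rw [syndrome_add, hθ, bits_add_self]
  have h1 := card_syndrome_eq_zero_le (k := k) (m := m) (h.imp hne hne)
  have h2 := Nat.mul_le_mul_right (2 ^ k) (Finset.card_le_card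
    (Finset.monotone_filter_right Finset.univ (fun θ _ => hiff θ)))
  have h3 := h2.trans h1
  rw [div_mul_eq_mul_div, le_div_iff₀ (by positivity), mul_comm (2 : ℝ)]
  exact_mod_cast h3

/-- The one-shot fidelity bound for `k + m` pairs, of which `k` are sacrificed. -/
theorem exists_isLOCC_fidelity (k m : ℕ) (p : Fin 4 → ℝ) (hp : ∀ x, 0 ≤ p x)
    (hsum : ∑ x, p x = 1) {l : ℝ} (hl0 : 0 ≤ l) (hl1 : l ≤ 1) :
    ∃ Λ : Matrix ((Fin (k + m) → Fin 2) × (Fin (k + m) → Fin 2))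
          ((Fin (k + m) → Fin 2) × (Fin (k + m) → Fin 2)) ℂ →ₗ[ℂ]
        Matrix ((Fin m → Fin 2) × (Fin m → Fin 2)) ((Fin m → Fin 2) × (Fin m → Fin 2)) ℂ,
      IsLOCC Λ ∧
      1 - (2 / 2 ^ k) ^ l * (∑ x, p x * Real.exp (-l * Real.log (p x))) ^ (k + m)
        ≤ (tensorPow sigmaPlus m *
            Λ (tensorPow (∑ x, (p x : ℂ) • proj (bellVec x)) (k + m))).trace.re := by
  classical
  obtain ⟨θ, dec, hdec⟩ := exists_hash_decoder (fun e : Fin (k + m) → Fin 4 => ∏ i, p (e i))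
    (fun e => Finset.prod_nonneg fun i _ => hp _)
    (by rw [← Fintype.sum_pow, hsum, one_pow])
    (fun (θ : Matrix (Fin k) (Fin m) (Fin 2) × Matrix (Fin (k + m)) (Fin (k + m)) (Fin 2))
      (e : Fin (k + m) → Fin 4) =>
        syndrome θ.1 θ.2 (fun i => bellX (e i)) (fun i => bellZ (e i)))
    (show (0 : ℝ) < 2 / 2 ^ k by positivity) hl0 hl1
    (fun e e' hne => by
      convert card_syndrome_eq_le (k := k) (m := m) ?_
      by_contra! h
      exact hne (funext fun i => bell_ext (congrFun h.1 i) (congrFun h.2 i)))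
  obtain ⟨Λ, hΛ, hF⟩ := exists_isLOCC_of_decoder θ.1 θ.2 dec p hp
  refine ⟨Λ, hΛ, le_trans (le_trans (le_of_eq ?_) hdec)
    (le_of_eq_of_le (Finset.sum_congr rfl fun e _ => by split_ifs <;> rfl) hF)⟩
  have hprod : ∀ e : Fin (k + m) → Fin 4, (∏ i, p (e i)) * Real.exp (-l * Real.log (∏ i, p (e i)))
      = ∏ i, p (e i) * Real.exp (-l * Real.log (p (e i))) := by
    intro e
    rw [Finset.prod_mul_distrib]
    by_cases h0 : ∏ i, p (e i) = 0
    · rw [h0, zero_mul, zero_mul]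
    · rw [Real.log_prod (fun i hi => Finset.prod_ne_zero_iff.1 h0 i hi), Finset.mul_sum,
        Real.exp_sum]
  simp only [hprod]
  rw [Fintype.sum_pow]

end BellHashing

theorem mainTheorem2
    (ρ : Matrix (Fin 2 × Fin 2) (Fin 2 × Fin 2) ℂ)
    (hρ : QInfo.IsBellDiagonalState ρ) (hS : QInfo.entropy ρ < 1)
    (F : ℝ) (hF : F < 1) :
    ∃ N : ℕ, ∀ n : ℕ, N ≤ n →
      ∃ (m : ℕ)
        (Λ : Matrix ((Fin n → Fin 2) × (Fin n → Fin 2)) ((Fin n → Fin 2) × (Fin n → Fin 2)) ℂ →ₗ[ℂ]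
          Matrix ((Fin m → Fin 2) × (Fin m → Fin 2)) ((Fin m → Fin 2) × (Fin m → Fin 2)) ℂ),
        QInfo.IsLOCC Λ ∧
        (n : ℝ) / 2 * (1 - QInfo.entropy ρ) ≤ (m : ℝ) ∧
        F ≤ (QInfo.tensorPow QInfo.sigmaPlus m * Λ (QInfo.tensorPow ρ n)).trace.re := by
  obtain ⟨p, hp, hsum, hρp, hent⟩ := BellHashing.exists_spectrum_of_isBellDiagonalState hρ
  set S := QInfo.entropy ρ with hSdef
  have hlog2 : 0 < Real.log 2 := Real.log_pos one_lt_two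
  have hS2 : -∑ x, p x * Real.log (p x) = S * Real.log 2 := by
    rw [hent, neg_mul, Finset.sum_mul]
    congr 1
    refine Finset.sum_congr rfl fun x _ => ?_
    rw [Real.logb]
    field_simp
  have hS0 : 0 ≤ S := by
    rw [hent, neg_nonneg]
    refine Finset.sum_nonpos fun x _ => mul_nonpos_of_nonneg_of_nonpos (hp x) ?_
    refine Real.logb_nonpos one_lt_two (hp x) ?_
    rw [← hsum]
    exact Finset.single_le_sum (fun y _ => hp y) (Finset.mem_univ x)
  -- the rate `(1 - S) / 2` leaves `(1 + S) / 2 > S` parity bits per pair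
  obtain ⟨l, hl0, hl1, hq⟩ := BellHashing.exists_exponent_lt_one p hsum
    (c := (1 + S) / 2 * Real.log 2) (by rw [hS2]; nlinarith)
  set G := ∑ x, p x * Real.exp (-l * Real.log (p x)) with hG
  have hG0 : 0 ≤ G := Finset.sum_nonneg fun x _ => mul_nonneg (hp x) (Real.exp_pos _).le
  set q := Real.exp (-l * ((1 + S) / 2 * Real.log 2)) * G with hqdef
  have hq0 : 0 ≤ q := mul_nonneg (Real.exp_pos _).le hG0
  obtain ⟨N, hN⟩ := exists_pow_lt_of_lt_one (show (0 : ℝ) < (1 - F) / 4 by linarith) hq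
  refine ⟨max N 2, fun n hn => ?_⟩
  have hnN : N ≤ n := (le_max_left _ _).trans hn
  have hn2 : (2 : ℝ) ≤ n := by exact_mod_cast (le_max_right _ _).trans hn
  set m := ⌈(n : ℝ) / 2 * (1 - S)⌉₊ with hm
  have hm_ge : (n : ℝ) / 2 * (1 - S) ≤ m := Nat.le_ceil _
  have hm_lt : (m : ℝ) < (n : ℝ) / 2 * (1 - S) + 1 :=
    Nat.ceil_lt_add_one (mul_nonneg (by positivity) (by linarith))
  have hmn : m ≤ n := by
    refine Nat.ceil_le.2 ?_
    nlinarith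
  obtain ⟨k, hk⟩ := Nat.exists_eq_add_of_le' hmn
  clear_value m
  subst hk
  obtain ⟨Λ, hΛ, hfid⟩ := BellHashing.exists_isLOCC_fidelity k m p hp hsum hl0.le hl1
  refine ⟨m, Λ, hΛ, hm_ge, ?_⟩
  rw [hρp]
  refine le_trans ?_ hfid
  -- rounding `m` up costs at most one parity bit and the hash collisions another, whence `4 = 2 ^ 2`
  have hpow : ((2 : ℝ) / 2 ^ k) ^ l
      ≤ 4 * Real.exp (-l * ((1 + S) / 2 * Real.log 2)) ^ (k + m) := by
    have h4 : (4 : ℝ) = Real.exp (2 * Real.log 2) := by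
      rw [two_mul, Real.exp_add, Real.exp_log two_pos]; norm_num
    have hbase : Real.log (2 / 2 ^ k) = (1 - k) * Real.log 2 := by
      rw [Real.log_div two_ne_zero (by positivity), Real.log_pow]; ring
    rw [Real.rpow_def_of_pos (by positivity), hbase, ← Real.exp_nat_mul, h4, ← Real.exp_add]
    refine Real.exp_le_exp.2 ?_
    push_cast at hm_lt ⊢
    have h1 : l * (1 - k + (k + m) * ((1 + S) / 2)) ≤ 2 := by
      have : (1 : ℝ) - k + (k + m) * ((1 + S) / 2) ≤ 2 := by linarith
      nlinarith
    nlinarith [mul_le_mul_of_nonneg_right h1 hlog2.le]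
  have hpowG : ((2 : ℝ) / 2 ^ k) ^ l * G ^ (k + m) ≤ 4 * q ^ (k + m) := by
    rw [hqdef, mul_pow, ← mul_assoc]
    exact mul_le_mul_of_nonneg_right hpow (by positivity)
  have hqn : q ^ (k + m) ≤ q ^ N := pow_le_pow_of_le_one hq0 hq.le hnN
  linarith
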